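/- Let $(\Omega,\mathcal F,\mathbb P)$ be a probability space. For measurable $g_n:\Omega\to\mathbb R$ and measurable $g:\Omega\to[-\infty,\infty]$, write $g_n\xrightarrow{hC}g$ ("$g_n$ converges hereditarily in Cesàro mean to $g$, $\mathbb P$-a.e.") if for every subsequence $(g_{n_j})_{j\ge1}$ we have $\lim_{J\to\infty}\frac1J\sum_{j=1}^J g_{n_j}=g$, $\mathbb P$-a.e. The convention $\infty\cdot 0=0$ is used. Let $f_1,f_2,\dots:\Omega\to[0,\infty)$ be measurable, and put $f_n^{(k)}:=f_n\,\mathbf 1_{\{k-1\le f_n<k\}}$ for $n,k\in\mathbb N=\{1,2,\dots\}$. (a) There exist a subsequence, denoted again $(f_n)$, and measurable functions $f^{(k)}:\Omega\to[0,\infty)$, $k\in\mathbb N$, such that $f_n^{(k)}\xrightarrow{hC}f^{(k)}$ as $n\to\infty$, for every $k\in\mathbb N$. Now let $(f_n)$ be any subsequence, and $f^{(k)}$ any functions, as in (a), and set $f:=\sum_{k\in\mathbb N}f^{(k)}:\Omega\to[0,\infty]$ and $A_\infty:=\{f=\infty\}$. (b) There exist a further subsequence, denoted again $(f_n)$, and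 a measurable set $A\supseteq A_\infty$ such that $$f_n\xrightarrow{hC}f_*:=\max\big(f,\ \infty\cdot\mathbf 1_A\big).$$ (c) If, for a further subsequence as in (b), $\lim_{K\to\infty}\limsup_{n\to\infty}\mathbb P(f_n\ge K,\ f<\infty)=0$, then every set $A$ as in (b) for this subsequence equals $A_\infty$ up to a $\mathbb P$-null set, so that $f_*=f$, $\mathbb P$-a.e.; and in (b) the subsequence and $A$ can be chosen so that, if this condition holds for it, $A=A_\infty$ and $f_*=f$ everywhere. -/

import Mathlib

open MeasureTheory Filter Topology
open scoped ENNReal NNReal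

/-- The sequence `f` of real functions converges hereditarily in Cesàro mean, `μ`-a.e., to the
measurable extended-real-valued function `g`: along every subsequence `f ∘ φ` the Cesàro averages
converge to `g` almost everywhere. The exceptional null set may depend on the subsequence. -/
def ConvergesHereditarilyInCesaroMean {Ω : Type*} [MeasurableSpace Ω] (μ : Measure Ω)
    (f : ℕ → Ω → ℝ) (g : Ω → EReal) : Prop :=
  Measurable g ∧ ∀ φ : ℕ → ℕ, StrictMono φ → ∀ᵐ ω ∂μ,
    Tendsto (fun K : ℕ => (((1 / (K : ℝ)) * ∑ j ∈ Finset.range K, f (φ j) ω : ℝ) : EReal))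
      atTop (𝓝 (g ω))

/-- The piece `h · 1{k ≤ h < k + 1}` of a function `h`; the index `k` runs over `0, 1, 2, …`,
so that this is the piece `h · 1{k' - 1 ≤ h < k'}` with `k' = k + 1 = 1, 2, 3, …`. -/
noncomputable def truncatedPiece {Ω : Type*} (h : Ω → ℝ) (k : ℕ) : Ω → ℝ :=
  Set.indicator {ω | (k : ℝ) ≤ h ω ∧ h ω < (k : ℝ) + 1} h

/-- `F k : Ω → [0, ∞)` is, for every `k`, a measurable hereditary Cesàro limit of the `k`-th
pieces of the sequence `f`. -/
def ArePieceLimits {Ω : Type*} [MeasurableSpace Ω] (μ : Measure Ω)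
    (f : ℕ → Ω → ℝ) (F : ℕ → Ω → ℝ≥0) : Prop :=
  ∀ k : ℕ, Measurable (F k) ∧
    ConvergesHereditarilyInCesaroMean μ (fun n => truncatedPiece (f n) k)
      (fun ω => ((F k ω : ℝ) : EReal))

/-- The sum `∑ₖ F k`, with values in `[0, ∞]`. -/
noncomputable def pieceSum {Ω : Type*} (F : ℕ → Ω → ℝ≥0) (ω : Ω) : ℝ≥0∞ :=
  ∑' k : ℕ, (F k ω : ℝ≥0∞)

/-- The function `max (f, ∞ · 1_A)`, with the convention `∞ · 0 = 0`. -/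
noncomputable def maxTopOn {Ω : Type*} (f : Ω → ℝ≥0∞) (A : Set Ω) (ω : Ω) : ℝ≥0∞ :=
  max (f ω) (∞ * A.indicator (fun _ => (1 : ℝ≥0∞)) ω)

/-- The condition `lim_{K → ∞} limsup_{n → ∞} μ (fₙ ≥ K, f < ∞) = 0`. -/
def AsymptoticallyBoundedOnFinite {Ω : Type*} [MeasurableSpace Ω] (μ : Measure Ω)
    (fn : ℕ → Ω → ℝ) (f : Ω → ℝ≥0∞) : Prop :=
  Tendsto (fun K : ℕ => limsup (fun n : ℕ => μ {ω | (K : ℝ) ≤ fn n ω ∧ f ω < ∞}) atTop)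
    atTop (𝓝 0)

/-! The engine is a strong law (`ae_tendsto_average_of_quasiOrthogonal`): if `∫ Z i * Z l`, `i < l`,
is at most `1 / (l + 1)` in absolute value and the second moments, divided by `(i + 1) ^ 2`, are
summable, then averages of nonnegative `x i = Z i + s i` follow the limit of `s i`. By weak
compactness in L², a bounded sequence can be thinned until its differences from the weak limit are
quasi-orthogonal. Further thinning preserves this, so the convergence is hereditary. This gives (a),
and also limits `q K` of the indicators of `{fₙ ≥ K}`.

For (b), `A` is the set where `f = ∞` or `q K` does not tend to 0. On `A` the averages dominate
those of `fₙ 1{fₙ < K}` and of `K 1{fₙ ≥ K}`, whose limits are unbounded in `K`. Off `A`, an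
equivalent finite measure makes `f` square integrable. The asymptotic tails `∫ q K` then tend to 0,
and integrability of `f` makes them summable. As in Komlós' theorem, truncating the `i`-th term at
level `i` changes only finitely many terms almost everywhere, and the strong law applies to the
truncations (`exists_subseq_hereditaryCesaro_of_tight`).

For (c), the integral of `q K` over `{f < ∞}` is at most the limsup in the condition, and `q K`
decreases in `K`; so `q K` tends to 0 a.e. on `{f < ∞}`. Uniqueness of limits carries this over to
every admissible `A`. -/

/-! ### Diagonal extraction and weak compactness. -/

/-- A subsequence along which a pairwise condition, holding for all large indices, holds for
all pairs. -/
theorem exists_strictMono_forall_pair {Q : ℕ → ℕ → Prop} {P : ℕ → ℕ → ℕ → Prop}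
    (hQ : ∀ j, ∀ᶠ n in atTop, Q j n) (hP : ∀ j m, ∀ᶠ n in atTop, P j m n) :
    ∃ φ : ℕ → ℕ, StrictMono φ ∧ (∀ j, Q j (φ j)) ∧ ∀ i j, i < j → P j (φ i) (φ j) := by
  -- The ranges suffice when `m = φ j`: then `j + 1 ≤ m + 1`, and all earlier values of `φ` are at
  -- most `m`.
  have key : ∀ m : ℕ, ∃ N, ∀ n ≥ N,
      (∀ j ∈ Finset.range (m + 2), Q j n) ∧
      ∀ j ∈ Finset.range (m + 2), ∀ k ∈ Finset.range (m + 1), P j k n := by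
    intro m
    rw [← eventually_atTop]
    refine ((Finset.eventually_all _).2 fun j _ => hQ j).and
      ((Finset.eventually_all _).2 fun j _ => (Finset.eventually_all _).2 fun k _ => hP j k)
  choose N hN using key
  obtain ⟨N₀, hN₀⟩ := eventually_atTop.1 (hQ 0)
  let φ : ℕ → ℕ := fun j => Nat.rec N₀ (fun _ x => max (x + 1) (N x)) j
  have hφs : ∀ j, φ (j + 1) = max (φ j + 1) (N (φ j)) := fun j => rfl
  have hφ : StrictMono φ := strictMono_nat_of_lt_succ fun j => by rw [hφs]; omega
  refine ⟨φ, hφ, fun j => ?_, fun i j hij => ?_⟩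
  · cases j with
    | zero => exact hN₀ _ le_rfl
    | succ j =>
      refine (hN (φ j) (φ (j + 1)) (by rw [hφs]; omega)).1 _ ?_
      have := hφ.le_apply (x := j)
      simp only [Finset.mem_range]; omega
  · cases j with
    | zero => omega
    | succ j =>
      have h1 := hφ.le_apply (x := j)
      have h2 := hφ.monotone (Nat.lt_succ_iff.1 hij)
      exact (hN (φ j) (φ (j + 1)) (by rw [hφs]; omega)).2 _ (by simp only [Finset.mem_range]; omega)
        _ (by simp only [Finset.mem_range]; omega)

/-- A bounded sequence in a Hilbert space has a subsequence converging weakly along the sequence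
and its limit. -/
theorem exists_subseq_tendsto_inner_sub {H : Type*} [NormedAddCommGroup H] [InnerProductSpace ℝ H]
    [CompleteSpace H] {x : ℕ → H} {C : ℝ} (hx : ∀ n, ‖x n‖ ≤ C) :
    ∃ y : H, ∃ φ : ℕ → ℕ, StrictMono φ ∧
      ∀ m, Tendsto (fun n => inner ℝ (x m - y) (x (φ n) - y)) atTop (𝓝 0) := by
  -- Weak-* sequential compactness needs separability. The test vectors `x m - y` all lie in this
  -- closed span.
  set K := (Submodule.span ℝ (Set.range x)).topologicalClosure with hK
  have hxK : ∀ n, x n ∈ K := fun n =>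
    Submodule.le_topologicalClosure _ (Submodule.subset_span ⟨n, rfl⟩)
  have : CompleteSpace K := (Submodule.isClosed_topologicalClosure _).completeSpace_coe
  have : TopologicalSpace.SeparableSpace K := by
    have h1 : TopologicalSpace.IsSeparable (Submodule.span ℝ (Set.range x) : Set H) :=
      (Set.countable_range x).isSeparable.span
    have h2 : TopologicalSpace.IsSeparable (K : Set H) := by
      rw [hK, Submodule.topologicalClosure_coe]; exact h1.closure
    exact h2.separableSpace
  let z : ℕ → K := fun n => ⟨x n, hxK n⟩
  obtain ⟨a, -, φ, hφ, ha⟩ := WeakDual.isSeqCompact_closedBall ℝ K 0 C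
    (x := fun n => StrongDual.toWeakDual (InnerProductSpace.toDual ℝ K (z n))) (fun n => by
      simpa [z] using hx n)
  set y : K := (InnerProductSpace.toDual ℝ K).symm (WeakDual.toStrongDual a) with hy
  have hconv : ∀ w : K, Tendsto (fun n => inner ℝ (z (φ n)) w) atTop (𝓝 (inner ℝ y w)) := by
    intro w
    have h := ((WeakDual.eval_continuous w).tendsto a).comp ha
    have e : inner ℝ y w = a w := by
      rw [hy, InnerProductSpace.toDual_symm_apply]; rfl
    rw [e]
    exact h
  refine ⟨y, φ, hφ, fun m => ?_⟩
  have h := (hconv (z m - y)).sub_const (inner ℝ y (z m - y))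
  rw [sub_self] at h
  refine h.congr fun n => ?_
  rw [← inner_sub_left, real_inner_comm]
  rfl

/-! ### A strong law for quasi-orthogonal sequences. -/

section QuasiOrthogonal

variable {Ω : Type*} [MeasurableSpace Ω] {μ : Measure Ω} {Z : ℕ → Ω → ℝ} {v : ℕ → ℝ}

/-- The `J` correlations with `Z J` sum to at most `J / (J + 1) ≤ 1`, so each new term costs at most
`v J + 2`. -/
theorem integral_sq_sum_le_of_quasiOrthogonal (hZ : ∀ i, MemLp (Z i) 2 μ)
    (horth : ∀ i l, i < l → |∫ ω, Z i ω * Z l ω ∂μ| ≤ 1 / ((l : ℝ) + 1))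
    (hv : ∀ i, ∫ ω, Z i ω ^ 2 ∂μ ≤ v i) (J : ℕ) :
    ∫ ω, (∑ i ∈ Finset.range J, Z i ω) ^ 2 ∂μ ≤ ∑ i ∈ Finset.range J, (v i + 2) := by
  induction J with
  | zero => simp
  | succ J ih =>
    have hS : MemLp (fun ω => ∑ i ∈ Finset.range J, Z i ω) 2 μ :=
      memLp_finsetSum _ fun i _ => hZ i
    have h1 := hS.integrable_sq
    have h2 : Integrable (fun ω => (∑ i ∈ Finset.range J, Z i ω) * Z J ω) μ :=
      hS.integrable_mul (hZ J)
    have h3 := (hZ J).integrable_sq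
    have e : ∀ ω, (∑ i ∈ Finset.range (J + 1), Z i ω) ^ 2 =
        (∑ i ∈ Finset.range J, Z i ω) ^ 2 + 2 * ((∑ i ∈ Finset.range J, Z i ω) * Z J ω)
          + Z J ω ^ 2 := fun ω => by rw [Finset.sum_range_succ]; ring
    have h5 : ∫ ω, (∑ i ∈ Finset.range (J + 1), Z i ω) ^ 2 ∂μ =
        ∫ ω, (∑ i ∈ Finset.range J, Z i ω) ^ 2 ∂μ
          + 2 * ∫ ω, (∑ i ∈ Finset.range J, Z i ω) * Z J ω ∂μ + ∫ ω, Z J ω ^ 2 ∂μ := by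
      rw [← integral_const_mul, ← integral_add h1 (h2.const_mul 2),
        ← integral_add (by exact h1.add (h2.const_mul 2)) h3]
      exact integral_congr_ae (Eventually.of_forall e)
    rw [h5, Finset.sum_range_succ]
    have h4 : ∫ ω, (∑ i ∈ Finset.range J, Z i ω) * Z J ω ∂μ ≤ 1 := by
      simp only [Finset.sum_mul]
      rw [integral_finsetSum _ fun i _ => by exact (hZ i).integrable_mul (hZ J)]
      calc _ ≤ ∑ i ∈ Finset.range J, 1 / ((J : ℝ) + 1) := Finset.sum_le_sum fun i hi =>
            (le_abs_self _).trans (horth i J (Finset.mem_range.1 hi))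
        _ ≤ 1 := by
            rw [Finset.sum_const, Finset.card_range, nsmul_eq_mul, mul_one_div,
              div_le_one (by positivity)]
            linarith
    linarith [hv J]

/-- After exchanging sums, `w i` is weighted by a geometric-type tail over `⌊c ^ m⌋₊ > i`, of order
`1 / (i + 1) ^ 2`. -/
theorem summable_sum_div_floor_pow_sq {w : ℕ → ℝ} (hw : ∀ i, 0 ≤ w i)
    (hs : Summable fun i : ℕ => w i / ((i : ℝ) + 1) ^ 2) {c : ℝ} (hc : 1 < c) :
    Summable fun m : ℕ =>
      (∑ i ∈ Finset.range ⌊c ^ m⌋₊, w i) / (⌊c ^ m⌋₊ : ℝ) ^ 2 := by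
  set D := c ^ 5 * (c - 1)⁻¹ ^ 3
  have hD0 : 0 ≤ D := by
    have : 0 < c - 1 := by linarith
    positivity
  refine summable_of_sum_range_le (c := ∑' i : ℕ, 4 * D * (w i / ((i : ℝ) + 1) ^ 2))
    (fun m => div_nonneg (Finset.sum_nonneg fun i _ => hw i) (by positivity)) fun N => ?_
  set R := (Finset.range N).sup fun m => ⌊c ^ m⌋₊
  have h1 : ∀ m ∈ Finset.range N, (∑ i ∈ Finset.range ⌊c ^ m⌋₊, w i) / (⌊c ^ m⌋₊ : ℝ) ^ 2 =
      ∑ i ∈ Finset.range R, if i < ⌊c ^ m⌋₊ then w i * (1 / (⌊c ^ m⌋₊ : ℝ) ^ 2) else 0 := by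
    intro m hm
    rw [← Finset.sum_filter, Finset.sum_div]
    refine Finset.sum_congr ?_ fun i _ => by rw [mul_one_div]
    ext i
    have : ⌊c ^ m⌋₊ ≤ R := Finset.le_sup (f := fun m => ⌊c ^ m⌋₊) hm
    simp only [Finset.mem_range, Finset.mem_filter]
    omega
  rw [Finset.sum_congr rfl h1, Finset.sum_comm]
  refine le_trans (Finset.sum_le_sum fun i _ => ?_)
    ((hs.mul_left (4 * D)).sum_le_tsum (Finset.range R)
      fun i _ => mul_nonneg (by positivity) (div_nonneg (hw i) (by positivity)))
  -- Halving turns `i + 1 ≤ ⌊c ^ m⌋₊` into the strict inequality needed by the tail bound, and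
  -- accounts for the factor 4.
  have hj : (0 : ℝ) < ((i : ℝ) + 1) / 2 := by positivity
  have h2 := sum_div_nat_floor_pow_sq_le_div_sq N hj hc
  rw [← Finset.sum_filter, ← Finset.mul_sum]
  calc _ ≤ w i * ∑ m ∈ Finset.range N with ((i : ℝ) + 1) / 2 < ⌊c ^ m⌋₊,
        1 / (⌊c ^ m⌋₊ : ℝ) ^ 2 := by
        refine mul_le_mul_of_nonneg_left (Finset.sum_le_sum_of_subset_of_nonneg ?_
          fun _ _ _ => by positivity) (hw i)
        intro m hm
        simp only [Finset.mem_filter] at hm ⊢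
        refine ⟨hm.1, ?_⟩
        have : (i : ℝ) + 1 ≤ ⌊c ^ m⌋₊ := by exact_mod_cast hm.2
        have : (0 : ℝ) ≤ i := by positivity
        linarith
    _ ≤ w i * (D / (((i : ℝ) + 1) / 2) ^ 2) := mul_le_mul_of_nonneg_left h2 (hw i)
    _ = _ := by field_simp; norm_num

/-- The squared averages along `⌊c ^ m⌋₊` have summable integrals, so their sum is finite a.e. -/
theorem ae_tendsto_average_floor_pow_of_quasiOrthogonal (hZ : ∀ i, MemLp (Z i) 2 μ)
    (horth : ∀ i l, i < l → |∫ ω, Z i ω * Z l ω ∂μ| ≤ 1 / ((l : ℝ) + 1))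
    (hv : ∀ i, ∫ ω, Z i ω ^ 2 ∂μ ≤ v i) (hs : Summable fun i : ℕ => v i / ((i : ℝ) + 1) ^ 2)
    {c : ℝ} (hc : 1 < c) :
    ∀ᵐ ω ∂μ, Tendsto (fun m : ℕ => (∑ i ∈ Finset.range ⌊c ^ m⌋₊, Z i ω) / (⌊c ^ m⌋₊ : ℝ))
      atTop (𝓝 0) := by
  have hv0 : ∀ i, 0 ≤ v i := fun i => (integral_nonneg fun ω => sq_nonneg _).trans (hv i)
  have hs' : Summable fun i : ℕ => (v i + 2) / ((i : ℝ) + 1) ^ 2 := by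
    have h2 : Summable fun i : ℕ => 2 / ((i : ℝ) + 1) ^ 2 := by
      have h3 := (summable_nat_add_iff 1).2 (Real.summable_one_div_nat_pow (p := 2) |>.2 one_lt_two)
      refine (h3.mul_left 2).congr fun i => ?_
      push_cast
      rw [mul_one_div]
    exact (hs.add h2).congr fun i => by rw [add_div]
  have hsum := summable_sum_div_floor_pow_sq (fun i => by linarith [hv0 i]) hs' hc
  set A : ℕ → Ω → ℝ := fun m ω =>
    (∑ i ∈ Finset.range ⌊c ^ m⌋₊, Z i ω) / (⌊c ^ m⌋₊ : ℝ) with hA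
  have hAL : ∀ m, MemLp (A m) 2 μ := fun m => by
    have : MemLp (fun ω => ∑ i ∈ Finset.range ⌊c ^ m⌋₊, Z i ω) 2 μ :=
      memLp_finsetSum _ fun i _ => hZ i
    simpa only [hA, div_eq_inv_mul] using this.const_mul (⌊c ^ m⌋₊ : ℝ)⁻¹
  have hint : ∀ m, ∫ ω, A m ω ^ 2 ∂μ ≤
      (∑ i ∈ Finset.range ⌊c ^ m⌋₊, (v i + 2)) / (⌊c ^ m⌋₊ : ℝ) ^ 2 := fun m => by
    simp only [hA, div_pow]
    rw [integral_div]
    gcongr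
    exact integral_sq_sum_le_of_quasiOrthogonal hZ horth hv _
  have hsumA : Summable fun m => ∫ ω, A m ω ^ 2 ∂μ :=
    Summable.of_nonneg_of_le (fun m => integral_nonneg fun ω => sq_nonneg _) hint hsum
  have hfin : ∫⁻ ω, ∑' m, ENNReal.ofReal (A m ω ^ 2) ∂μ ≠ ∞ := by
    rw [lintegral_tsum fun m => (hAL m).integrable_sq.aemeasurable.ennreal_ofReal]
    have : ∀ m, ∫⁻ ω, ENNReal.ofReal (A m ω ^ 2) ∂μ = ENNReal.ofReal (∫ ω, A m ω ^ 2 ∂μ) :=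
      fun m => (ofReal_integral_eq_lintegral_ofReal (hAL m).integrable_sq
        (Eventually.of_forall fun ω => sq_nonneg _)).symm
    simp only [this]
    exact hsumA.tsum_ofReal_ne_top
  filter_upwards [ae_lt_top' (AEMeasurable.tsum fun m =>
    (hAL m).integrable_sq.aemeasurable.ennreal_ofReal) hfin] with ω hω
  have h1 := ENNReal.tendsto_atTop_zero_of_tsum_ne_top hω.ne
  have h2 : Tendsto (fun m => A m ω ^ 2) atTop (𝓝 0) := by
    have := (ENNReal.tendsto_toReal ENNReal.zero_ne_top).comp h1
    simpa only [Function.comp_def, ENNReal.toReal_ofReal (sq_nonneg _), ENNReal.toReal_zero]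
      using this
  have h3 := h2.sqrt
  simp only [Real.sqrt_sq_eq_abs, Real.sqrt_zero] at h3
  exact (tendsto_zero_iff_abs_tendsto_zero _).2 h3

/-- Averages of nonnegative functions that are eventually the sum of a quasi-orthogonal sequence
and a convergent one. -/
theorem ae_tendsto_average_of_quasiOrthogonal (hZ : ∀ i, MemLp (Z i) 2 μ)
    (horth : ∀ i l, i < l → |∫ ω, Z i ω * Z l ω ∂μ| ≤ 1 / ((l : ℝ) + 1))
    (hv : ∀ i, ∫ ω, Z i ω ^ 2 ∂μ ≤ v i) (hs : Summable fun i : ℕ => v i / ((i : ℝ) + 1) ^ 2)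
    {x s : ℕ → Ω → ℝ} {g : Ω → ℝ} (hx : ∀ i ω, 0 ≤ x i ω)
    (hsg : ∀ᵐ ω ∂μ, Tendsto (fun i => s i ω) atTop (𝓝 (g ω)))
    (hxs : ∀ᵐ ω ∂μ, ∀ᶠ i in atTop, x i ω = Z i ω + s i ω) :
    ∀ᵐ ω ∂μ, Tendsto (fun J : ℕ => (∑ i ∈ Finset.range J, x i ω) / (J : ℝ)) atTop
      (𝓝 (g ω)) := by
  have hfl : ∀ c : ℝ, 1 < c → Tendsto (fun m : ℕ => ⌊c ^ m⌋₊) atTop atTop := fun c hc =>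
    tendsto_nat_floor_atTop.comp (tendsto_pow_atTop_atTop_of_one_lt hc)
  have hc : ∀ k : ℕ, (1 : ℝ) < 1 + 1 / ((k : ℝ) + 1) := fun k => by
    have : (0 : ℝ) < 1 / ((k : ℝ) + 1) := by positivity
    linarith
  have hZ0 := ae_all_iff.2 fun k : ℕ =>
    ae_tendsto_average_floor_pow_of_quasiOrthogonal hZ horth hv hs (hc k)
  filter_upwards [hZ0, hsg, hxs] with ω h1 h2 h3
  -- Nonnegativity makes the partial sums monotone, so convergence along `⌊c ^ m⌋₊` for ratios `c`
  -- tending to 1 suffices.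
  refine tendsto_div_of_monotone_of_tendsto_div_floor_pow
    (fun J => ∑ i ∈ Finset.range J, x i ω) (g ω) ?_ (fun k => 1 + 1 / ((k : ℝ) + 1)) hc ?_ ?_
  · exact fun a b hab => Finset.sum_le_sum_of_subset_of_nonneg
      (Finset.range_mono hab) fun i _ _ => hx i ω
  · simpa using (tendsto_one_div_add_atTop_nhds_zero_nat (𝕜 := ℝ)).const_add 1
  · intro k
    have h4 : Tendsto (fun i => x i ω - Z i ω) atTop (𝓝 (g ω)) :=
      h2.congr' (h3.mono fun i hi => by simp only [hi]; ring)
    have h5 := (h4.cesaro.comp (hfl _ (hc k))).add (h1 k)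
    rw [add_zero] at h5
    refine h5.congr fun m => ?_
    simp only [Function.comp_def, Finset.sum_sub_distrib]
    ring

end QuasiOrthogonal

/-! ### Hereditary Cesàro limits of bounded sequences. -/

/-- Hereditary almost everywhere Cesàro convergence to a real function. -/
def HereditaryCesaro {Ω : Type*} [MeasurableSpace Ω] (μ : Measure Ω)
    (u : ℕ → Ω → ℝ) (g : Ω → ℝ) : Prop :=
  ∀ φ : ℕ → ℕ, StrictMono φ → ∀ᵐ ω ∂μ,
    Tendsto (fun J : ℕ => (∑ j ∈ Finset.range J, u (φ j) ω) / (J : ℝ)) atTop (𝓝 (g ω))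

/-- Infinitely many terms beyond a level `a ≠ c` would form a subsequence whose averages stay beyond
`a`. -/
theorem tendsto_of_forall_subseq_average {x : ℕ → ℝ} {c : ℝ}
    (h : ∀ φ : ℕ → ℕ, StrictMono φ →
      Tendsto (fun J : ℕ => (∑ j ∈ Finset.range J, x (φ j)) / (J : ℝ)) atTop (𝓝 c)) :
    Tendsto x atTop (𝓝 c) := by
  refine tendsto_order.2 ⟨fun a ha => ?_, fun a ha => ?_⟩ <;> by_contra hne
  · obtain ⟨φ, hφ, hx⟩ := extraction_of_frequently_atTop (not_eventually.1 hne)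
    refine ha.not_ge (le_of_tendsto (h φ hφ) ?_)
    filter_upwards [eventually_gt_atTop 0] with J hJ
    rw [div_le_iff₀ (by exact_mod_cast hJ)]
    calc _ ≤ ∑ j ∈ Finset.range J, a := Finset.sum_le_sum fun j _ => not_lt.1 (hx j)
      _ = _ := by simp [mul_comm]
  · obtain ⟨φ, hφ, hx⟩ := extraction_of_frequently_atTop (not_eventually.1 hne)
    refine ha.not_ge (ge_of_tendsto (h φ hφ) ?_)
    filter_upwards [eventually_gt_atTop 0] with J hJ
    rw [le_div_iff₀ (by exact_mod_cast hJ)]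
    calc _ = ∑ j ∈ Finset.range J, a := by simp [mul_comm]
      _ ≤ _ := Finset.sum_le_sum fun j _ => not_lt.1 (hx j)

section

variable {Ω : Type*} [MeasurableSpace Ω] {μ ν : Measure Ω}

namespace HereditaryCesaro

variable {u : ℕ → Ω → ℝ} {g : Ω → ℝ}

theorem comp_strictMono (h : HereditaryCesaro μ u g) {φ : ℕ → ℕ} (hφ : StrictMono φ) :
    HereditaryCesaro μ (fun n => u (φ n)) g :=
  fun ψ hψ => h (fun j => φ (ψ j)) (hφ.comp hψ)

theorem of_absolutelyContinuous (h : HereditaryCesaro μ u g) (hν : ν ≪ μ) :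
    HereditaryCesaro ν u g :=
  fun ψ hψ => hν.ae_le (h ψ hψ)

theorem congr_ae (h : HereditaryCesaro μ u g) {g' : Ω → ℝ} (hg : g =ᵐ[μ] g') :
    HereditaryCesaro μ u g' := fun φ hφ => by
  filter_upwards [h φ hφ, hg] with ω h1 h2
  rwa [← h2]

theorem const_mul (h : HereditaryCesaro μ u g) (c : ℝ) :
    HereditaryCesaro μ (fun n ω => c * u n ω) (fun ω => c * g ω) := fun φ hφ => by
  filter_upwards [h φ hφ] with ω h1
  refine (h1.const_mul c).congr fun J => ?_
  rw [← Finset.mul_sum, mul_div_assoc]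

theorem finset_sum {ι : Type*} {u : ι → ℕ → Ω → ℝ} {g : ι → Ω → ℝ} (s : Finset ι)
    (h : ∀ i ∈ s, HereditaryCesaro μ (u i) (g i)) :
    HereditaryCesaro μ (fun n ω => ∑ i ∈ s, u i n ω) (fun ω => ∑ i ∈ s, g i ω) := fun φ hφ => by
  have := (Finset.eventually_all s).2 fun i hi => h i hi φ hφ
  filter_upwards [this] with ω h1
  refine (tendsto_finsetSum s h1).congr fun J => ?_
  rw [← Finset.sum_div, Finset.sum_comm]

/-- Dominated convergence handles the averages of the integrals along every subsequence, so the
integrals themselves converge. -/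
theorem tendsto_integral_mul (h : HereditaryCesaro μ u g)
    (hu : ∀ n, AEStronglyMeasurable (u n) μ) {C : ℝ} (hC : ∀ n ω, |u n ω| ≤ C)
    {Z : Ω → ℝ} (hZ : Integrable Z μ) :
    Tendsto (fun n => ∫ ω, u n ω * Z ω ∂μ) atTop (𝓝 (∫ ω, g ω * Z ω ∂μ)) := by
  refine tendsto_of_forall_subseq_average fun φ hφ => ?_
  have hi : ∀ n, Integrable (fun ω => u n ω * Z ω) μ := fun n =>
    hZ.bdd_mul (hu n) (Eventually.of_forall fun ω => hC n ω)
  have e : ∀ J : ℕ, (∑ j ∈ Finset.range J, ∫ ω, u (φ j) ω * Z ω ∂μ) / (J : ℝ) =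
      ∫ ω, (∑ j ∈ Finset.range J, u (φ j) ω) / (J : ℝ) * Z ω ∂μ := fun J => by
    rw [← integral_finsetSum _ fun j _ => hi (φ j), ← integral_div]
    refine integral_congr_ae (Eventually.of_forall fun ω => ?_)
    simp only [← Finset.sum_mul]
    ring
  simp only [e]
  refine tendsto_integral_of_dominated_convergence (fun ω => C * |Z ω|) (fun J => ?_)
    (hZ.abs.const_mul C) (fun J => Eventually.of_forall fun ω => ?_) ?_
  · refine AEStronglyMeasurable.mul ?_ hZ.1
    simp only [div_eq_mul_inv]
    exact (Finset.aestronglyMeasurable_fun_sum _ fun j _ => hu (φ j)).mul_const _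
  · have hC0 : 0 ≤ C := (abs_nonneg _).trans (hC 0 ω)
    rw [Real.norm_eq_abs, abs_mul]
    refine mul_le_mul_of_nonneg_right ?_ (abs_nonneg _)
    rw [abs_div, Nat.abs_cast]
    refine div_le_of_le_mul₀ (by positivity) hC0 ?_
    calc _ ≤ ∑ j ∈ Finset.range J, |u (φ j) ω| := Finset.abs_sum_le_sum_abs _ _
      _ ≤ ∑ j ∈ Finset.range J, C := Finset.sum_le_sum fun j _ => hC _ _
      _ = _ := by simp [mul_comm]
  · filter_upwards [h φ hφ] with ω h1
    exact h1.mul_const _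

end HereditaryCesaro

theorem exists_subseq_hereditaryCesaro_of_mem_Icc [IsFiniteMeasure μ] {u : ℕ → Ω → ℝ}
    (hu : ∀ n, Measurable (u n)) (h01 : ∀ n ω, u n ω ∈ Set.Icc (0 : ℝ) 1) :
    ∃ φ : ℕ → ℕ, StrictMono φ ∧ ∃ g : Ω → ℝ, Measurable g ∧ (∀ ω, g ω ∈ Set.Icc (0 : ℝ) 1) ∧
      HereditaryCesaro μ (fun n => u (φ n)) g := by
  have hb : ∀ n, ∀ᵐ ω ∂μ, ‖u n ω‖ ≤ 1 := fun n => Eventually.of_forall fun ω => by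
    rw [Real.norm_eq_abs, abs_of_nonneg (h01 n ω).1]; exact (h01 n ω).2
  have hL : ∀ n, MemLp (u n) 2 μ := fun n => MemLp.of_bound (hu n).aestronglyMeasurable 1 (hb n)
  let x : ℕ → Lp ℝ 2 μ := fun n => (hL n).toLp (u n)
  obtain ⟨C, hx⟩ : ∃ C : ℝ, ∀ n, ‖x n‖ ≤ C := by
    refine ⟨(μ Set.univ ^ (2 : ℝ≥0∞).toReal⁻¹ * ENNReal.ofReal 1).toReal, fun n => ?_⟩
    rw [Lp.norm_toLp]
    refine ENNReal.toReal_mono ?_ (eLpNorm_le_of_ae_bound (hb n))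
    exact ENNReal.mul_ne_top (ENNReal.rpow_ne_top_of_nonneg (by positivity) (measure_ne_top _ _))
      ENNReal.ofReal_ne_top
  obtain ⟨y, φ, hφ, hy⟩ := exists_subseq_tendsto_inner_sub hx
  have hinner : ∀ m n, inner ℝ (x m - y) (x n - y) =
      ∫ ω, (u m ω - y ω) * (u n ω - y ω) ∂μ := fun m n => by
    rw [L2.inner_def]
    refine integral_congr_ae ?_
    filter_upwards [Lp.coeFn_sub (x m) y, Lp.coeFn_sub (x n) y, (hL m).coeFn_toLp,
      (hL n).coeFn_toLp] with ω h1 h2 h3 h4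
    rw [h1, h2]
    simp only [Pi.sub_apply, x, h3, h4]
    simp [mul_comm]
  have hdiff : ∀ n, MemLp (fun ω => u n ω - y ω) 2 μ := fun n => (hL n).sub (Lp.memLp y)
  obtain ⟨ψ, hψ, -, hP⟩ := exists_strictMono_forall_pair (Q := fun _ _ => True)
    (P := fun j m n => |∫ ω, (u (φ m) ω - y ω) * (u (φ n) ω - y ω) ∂μ| ≤ 1 / ((j : ℝ) + 1))
    (fun _ => Eventually.of_forall fun _ => trivial) (fun j m => by
      have h := (hy (φ m)).abs
      rw [abs_zero] at h
      filter_upwards [h.eventually_le_const (show (0 : ℝ) < 1 / ((j : ℝ) + 1) by positivity)]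
        with n hn
      rwa [← hinner])
  have hHC : HereditaryCesaro μ (fun n => u (φ (ψ n))) y := fun σ hσ => by
    refine ae_tendsto_average_of_quasiOrthogonal
      (Z := fun i ω => u (φ (ψ (σ i))) ω - y ω) (s := fun _ => y)
      (v := fun _ => (C + ‖y‖) ^ 2) (fun i => hdiff _) (fun i l hil => ?_) (fun i => ?_) ?_
      (fun i ω => (h01 _ ω).1) (Eventually.of_forall fun ω => tendsto_const_nhds)
      (Eventually.of_forall fun ω => Eventually.of_forall fun i => by ring)
    -- Heredity: since `l ≤ σ l`, the correlation bound only improves along `σ`.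
    · refine (hP _ _ (hσ hil)).trans ?_
      have : l ≤ σ l := hσ.le_apply
      gcongr
    · simp only [sq]
      rw [← hinner, real_inner_self_eq_norm_sq, ← sq]
      gcongr
      exact (norm_sub_le _ _).trans (add_le_add_left (hx _) _)
    · have h3 := (summable_nat_add_iff 1).2 (Real.summable_one_div_nat_pow (p := 2) |>.2 one_lt_two)
      refine (h3.mul_left ((C + ‖y‖) ^ 2)).congr fun i => ?_
      push_cast
      rw [mul_one_div]
  -- Clamping gives a version with values in `[0, 1]` everywhere; it agrees a.e. with `y`, a limit
  -- of averages in `[0, 1]`.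
  refine ⟨fun n => φ (ψ n), hφ.comp hψ, fun ω => max 0 (min (y ω) 1),
    measurable_const.max ((Lp.stronglyMeasurable y).measurable.min measurable_const),
    fun ω => ⟨le_max_left _ _, max_le zero_le_one (min_le_right _ _)⟩, hHC.congr_ae ?_⟩
  filter_upwards [hHC id strictMono_id] with ω hω
  have h0 : 0 ≤ y ω := ge_of_tendsto' hω fun J =>
    div_nonneg (Finset.sum_nonneg fun j _ => (h01 _ ω).1) (Nat.cast_nonneg J)
  have h1 : y ω ≤ 1 := le_of_tendsto' hω fun J => by
    refine div_le_one_of_le₀ ?_ (Nat.cast_nonneg J)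
    calc _ ≤ ∑ j ∈ Finset.range J, (1 : ℝ) := Finset.sum_le_sum fun j _ => (h01 _ ω).2
      _ = _ := by simp
  rw [min_eq_left h1, max_eq_right h0]

/-- Countably many bounded sequences have hereditary Cesàro limits along a common subsequence. -/
theorem exists_subseq_forall_hereditaryCesaro_of_mem_Icc [IsFiniteMeasure μ]
    {u : ℕ → ℕ → Ω → ℝ} (hu : ∀ k n, Measurable (u k n))
    (h01 : ∀ k n ω, u k n ω ∈ Set.Icc (0 : ℝ) 1) :
    ∃ φ : ℕ → ℕ, StrictMono φ ∧ ∃ g : ℕ → Ω → ℝ, ∀ k, Measurable (g k) ∧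
      (∀ ω, g k ω ∈ Set.Icc (0 : ℝ) 1) ∧ HereditaryCesaro μ (fun n => u k (φ n)) (g k) := by
  -- A finite measure on `ℕ` with the null sets of counting measure: one extraction on `Ω × ℕ`
  -- serves all `k` at once.
  let ρ : Measure ℕ := (Measure.count : Measure ℕ).toFinite
  have hρ : ∀ {p : ℕ → Prop}, (∀ᵐ k ∂ρ, p k) → ∀ k, p k := fun {p} h k => by
    have h' : ∀ᵐ k ∂(Measure.count : Measure ℕ), p k := by
      have : ae ρ = ae (Measure.count : Measure ℕ) := ae_toFinite
      rwa [← this]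
    by_contra hk
    have h2 : (Measure.count : Measure ℕ) {k | ¬ p k} = 0 := h'
    rw [Measure.count_eq_zero_iff] at h2
    exact (Set.eq_empty_iff_forall_notMem.1 h2 k) hk
  obtain ⟨φ, hφ, g, hg, hg01, hHC⟩ := exists_subseq_hereditaryCesaro_of_mem_Icc (μ := μ.prod ρ)
    (u := fun n p => u p.2 n p.1)
    (fun n => measurable_from_prod_countable_left fun k => hu k n) (fun n p => h01 p.2 n p.1)
  refine ⟨φ, hφ, fun k ω => g (ω, k), fun k => ⟨hg.comp measurable_prodMk_right,
    fun ω => hg01 _, fun σ hσ => ?_⟩⟩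
  filter_upwards [Measure.ae_ae_of_ae_prod (hHC σ hσ)] with ω hω
  exact hρ hω k

end

/-! ### Truncations, tail sums and the tight case. -/

/-- The truncation `h · 1{h < K}`. -/
noncomputable def truncBelow {Ω : Type*} (h : Ω → ℝ) (K : ℕ) : Ω → ℝ :=
  Set.indicator {ω | h ω < K} h

section

variable {Ω : Type*} {h : Ω → ℝ}

theorem truncBelow_apply (h : Ω → ℝ) (K : ℕ) (ω : Ω) :
    truncBelow h K ω = if h ω < K then h ω else 0 := by
  simp [truncBelow, Set.indicator_apply]

theorem truncBelow_nonneg (hh : ∀ ω, 0 ≤ h ω) (K : ℕ) (ω : Ω) : 0 ≤ truncBelow h K ω :=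
  Set.indicator_nonneg (fun ω _ => hh ω) ω

theorem truncBelow_le (K : ℕ) (ω : Ω) : truncBelow h K ω ≤ K := by
  rw [truncBelow_apply]
  split_ifs with h1
  · exact h1.le
  · exact Nat.cast_nonneg K

theorem measurable_truncBelow [MeasurableSpace Ω] (hh : Measurable h) (K : ℕ) :
    Measurable (truncBelow h K) :=
  hh.indicator (measurableSet_lt hh measurable_const)

/-- With `m = ⌊h ω⌋₊ < K`, the square is at most `(m + 1) ^ 2`, the sum of the first `m + 1` odd
numbers. Integrated, this bounds second moments by tails. -/
theorem truncBelow_sq_le (hh : ∀ ω, 0 ≤ h ω) (K : ℕ) (ω : Ω) :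
    truncBelow h K ω ^ 2 ≤
      ∑ k ∈ Finset.range K, (2 * (k : ℝ) + 1) * Set.indicator {ω | (k : ℝ) ≤ h ω} 1 ω := by
  have h0 : ∀ k ∈ Finset.range K,
      0 ≤ (2 * (k : ℝ) + 1) * Set.indicator {ω | (k : ℝ) ≤ h ω} 1 ω := fun k _ =>
    mul_nonneg (by positivity) (Set.indicator_nonneg (fun _ _ => zero_le_one) _)
  rw [truncBelow_apply]
  split_ifs with h1
  · set m := ⌊h ω⌋₊
    have hm : m < K := (Nat.floor_lt (hh ω)).2 h1
    have hsq : ∀ m : ℕ, ∑ k ∈ Finset.range m, (2 * (k : ℝ) + 1) = (m : ℝ) ^ 2 := fun m => by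
      induction m with
      | zero => simp
      | succ m ih => rw [Finset.sum_range_succ, ih]; push_cast; ring
    calc h ω ^ 2 ≤ ((m + 1 : ℕ) : ℝ) ^ 2 := by
          have := (Nat.lt_floor_add_one (h ω)).le
          have h2 := hh ω
          push_cast
          gcongr
      _ = ∑ k ∈ Finset.range (m + 1), (2 * (k : ℝ) + 1) := (hsq _).symm
      _ = ∑ k ∈ Finset.range (m + 1),
            (2 * (k : ℝ) + 1) * Set.indicator {ω | (k : ℝ) ≤ h ω} 1 ω := by
          refine Finset.sum_congr rfl fun k hk => ?_
          have : (k : ℝ) ≤ h ω :=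
            (Nat.le_floor_iff (hh ω)).1 (Nat.lt_succ_iff.1 (Finset.mem_range.1 hk))
          rw [Set.indicator_of_mem (by exact this)]
          simp
      _ ≤ _ := Finset.sum_le_sum_of_subset_of_nonneg (Finset.range_mono hm) fun k hk _ => h0 k hk
  · simpa using Finset.sum_nonneg h0

theorem sum_indicator_le_truncBelow_add (hh : ∀ ω, 0 ≤ h ω) (N K : ℕ) (ω : Ω) :
    ∑ k ∈ Finset.range N, Set.indicator {ω | ((k + 1 : ℕ) : ℝ) ≤ h ω} (1 : Ω → ℝ) ω ≤
      truncBelow h K ω + N * Set.indicator {ω | (K : ℝ) ≤ h ω} 1 ω := by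
  rw [truncBelow_apply]
  split_ifs with h1
  · rw [Set.indicator_of_notMem (by simpa using h1), mul_zero, add_zero]
    calc _ = ∑ k ∈ Finset.range N with k + 1 ≤ ⌊h ω⌋₊, (1 : ℝ) := by
          rw [Finset.sum_filter]
          refine Finset.sum_congr rfl fun k _ => ?_
          simp only [Set.indicator_apply, Set.mem_ofPred_eq, Nat.le_floor_iff (hh ω), Pi.one_apply]
      _ = (Finset.card {k ∈ Finset.range N | k + 1 ≤ ⌊h ω⌋₊} : ℝ) := by simp
      _ ≤ (⌊h ω⌋₊ : ℝ) := by
          have : Finset.card {k ∈ Finset.range N | k + 1 ≤ ⌊h ω⌋₊} ≤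
              (Finset.range ⌊h ω⌋₊).card := Finset.card_le_card fun k hk => by
            simp only [Finset.mem_filter, Finset.mem_range] at hk ⊢; omega
          rw [Finset.card_range] at this
          exact_mod_cast this
      _ ≤ h ω := Nat.floor_le (hh ω)
  · rw [Set.indicator_of_mem (by simpa using h1), zero_add, Pi.one_apply, mul_one]
    calc _ ≤ ∑ k ∈ Finset.range N, (1 : ℝ) := Finset.sum_le_sum fun k _ =>
          Set.indicator_le_self' (f := (1 : Ω → ℝ)) (fun _ _ => zero_le_one) ω
      _ = _ := by simp

end

/-- After exchanging sums, the tail of `1 / (i + 1) ^ 2` over `i > k` is at most `2 / (k + 1)`,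
which absorbs `2 * k + 1`. -/
theorem summable_sum_odd_mul_div_sq {b : ℕ → ℝ} (hb : ∀ k, 0 ≤ b k) (hs : Summable b) :
    Summable fun i : ℕ =>
      (∑ k ∈ Finset.range i, (2 * (k : ℝ) + 1) * b k) / ((i : ℝ) + 1) ^ 2 := by
  refine summable_of_sum_range_le (c := ∑' k, 4 * b k) (fun i => div_nonneg
    (Finset.sum_nonneg fun k _ => mul_nonneg (by positivity) (hb k)) (by positivity)) fun N => ?_
  have h1 : ∀ i ∈ Finset.range N,
      (∑ k ∈ Finset.range i, (2 * (k : ℝ) + 1) * b k) / ((i : ℝ) + 1) ^ 2 =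
      ∑ k ∈ Finset.range N,
        if k < i then (2 * (k : ℝ) + 1) * b k * (((i : ℝ) + 1) ^ 2)⁻¹ else 0 := by
    intro i hi
    rw [← Finset.sum_filter, Finset.sum_div]
    refine Finset.sum_congr ?_ fun k _ => by rw [div_eq_mul_inv]
    ext k
    simp only [Finset.mem_range, Finset.mem_filter] at hi ⊢
    omega
  rw [Finset.sum_congr rfl h1, Finset.sum_comm]
  refine le_trans (Finset.sum_le_sum fun k _ => ?_) ((hs.mul_left 4).sum_le_tsum (Finset.range N)
    fun k _ => mul_nonneg (by norm_num) (hb k))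
  rw [← Finset.sum_filter, ← Finset.mul_sum]
  have h2 : ∑ i ∈ Finset.range N with k < i, (((i : ℝ) + 1) ^ 2)⁻¹ ≤ 2 / ((k : ℝ) + 1) := by
    refine le_trans ?_ (sum_Ioo_inv_sq_le k N)
    have e : {i ∈ Finset.range N | k < i} = Finset.Ioo k N := by
      ext i; simp only [Finset.mem_filter, Finset.mem_range, Finset.mem_Ioo]; omega
    rw [e]
    refine Finset.sum_le_sum fun i hi => ?_
    have : (0 : ℝ) < i := by
      have := (Finset.mem_Ioo.1 hi).1
      exact_mod_cast (by omega : 0 < i)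
    gcongr
    linarith
  calc _ ≤ (2 * (k : ℝ) + 1) * b k * (2 / ((k : ℝ) + 1)) :=
        mul_le_mul_of_nonneg_left h2 (mul_nonneg (by positivity) (hb k))
    _ = ((2 * (k : ℝ) + 1) / ((k : ℝ) + 1)) * 2 * b k := by ring
    _ ≤ 2 * 2 * b k := by
        have : (2 * (k : ℝ) + 1) / ((k : ℝ) + 1) ≤ 2 := by
          rw [div_le_iff₀ (by positivity)]; linarith
        have := hb k
        gcongr
    _ = _ := by ring

section

variable {Ω : Type*} [MeasurableSpace Ω] {ν : Measure Ω} [IsFiniteMeasure ν]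
  {x s : ℕ → Ω → ℝ} {f : Ω → ℝ} {r : ℕ → ℝ}

/-- Integrate `sum_indicator_le_truncBelow_add` and let `n → ∞`: the first `N` tails sum to at most
`∫ f + N * r K`. Then `K → ∞` with `N` fixed removes the last term. -/
theorem summable_tail_of_hereditaryCesaro_truncBelow
    (hx : ∀ n, Measurable (x n)) (hx0 : ∀ n ω, 0 ≤ x n ω)
    (hs0 : ∀ K ω, 0 ≤ s K ω) (hsf : ∀ K, ∀ᵐ ω ∂ν, s K ω ≤ f ω) (hf : Integrable f ν)
    (hxs : ∀ K, HereditaryCesaro ν (fun n => truncBelow (x n) K) (s K))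
    (hr : ∀ K : ℕ, Tendsto (fun n => ν.real {ω | (K : ℝ) ≤ x n ω}) atTop (𝓝 (r K)))
    (hr0 : Tendsto r atTop (𝓝 0)) : Summable r := by
  have hrn : ∀ K, 0 ≤ r K := fun K => ge_of_tendsto' (hr K) fun n => measureReal_nonneg
  rw [← summable_nat_add_iff 1]
  refine summable_of_sum_range_le (c := ∫ ω, f ω ∂ν) (fun k => hrn _) fun N => ?_
  have hms : ∀ (K : ℕ) n, MeasurableSet {ω | (K : ℝ) ≤ x n ω} := fun K n =>
    measurableSet_le measurable_const (hx n)
  have hind : ∀ (K : ℕ) n, Integrable (Set.indicator {ω | (K : ℝ) ≤ x n ω} (1 : Ω → ℝ)) ν :=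
    fun K n => (integrable_const (1 : ℝ)).indicator (hms K n)
  have hTi : ∀ K n, Integrable (truncBelow (x n) K) ν := fun K n =>
    Integrable.of_bound (measurable_truncBelow (hx n) K).aestronglyMeasurable (K : ℝ)
      (Eventually.of_forall fun ω => by
        rw [Real.norm_eq_abs, abs_of_nonneg (truncBelow_nonneg (hx0 n) K ω)]
        exact truncBelow_le K ω)
  have hsi : ∀ K, ∫ ω, s K ω ∂ν ≤ ∫ ω, f ω ∂ν := fun K =>
    integral_mono_of_nonneg (Eventually.of_forall (hs0 K)) hf (hsf K)
  have key : ∀ K : ℕ, ∑ k ∈ Finset.range N, r (k + 1) ≤ ∫ ω, f ω ∂ν + N * r K := by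
    intro K
    have h1 : ∀ n, ∑ k ∈ Finset.range N, ν.real {ω | ((k + 1 : ℕ) : ℝ) ≤ x n ω} ≤
        ∫ ω, truncBelow (x n) K ω * 1 ∂ν + N * ν.real {ω | (K : ℝ) ≤ x n ω} := by
      intro n
      have h2 := integral_mono
        (f := fun ω => ∑ k ∈ Finset.range N,
          Set.indicator {ω | ((k + 1 : ℕ) : ℝ) ≤ x n ω} (1 : Ω → ℝ) ω)
        (g := fun ω => truncBelow (x n) K ω + N * Set.indicator {ω | (K : ℝ) ≤ x n ω} 1 ω)
        (integrable_finsetSum _ fun k _ => hind _ n) ((hTi K n).add ((hind K n).const_mul _))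
        (sum_indicator_le_truncBelow_add (hx0 n) N K)
      rw [integral_finsetSum _ fun k _ => hind _ n,
        integral_add (hTi K n) ((hind K n).const_mul _), integral_const_mul] at h2
      simpa only [integral_indicator_one (hms _ n), mul_one] using h2
    refine le_of_tendsto_of_tendsto' (tendsto_finsetSum _ fun k _ => hr (k + 1))
      (((hxs K).tendsto_integral_mul
        (fun n => (measurable_truncBelow (hx n) K).aestronglyMeasurable) (C := K)
        (fun n ω => ?_) (integrable_const 1)).add ((hr K).const_mul (N : ℝ))) h1 |>.trans ?_
    · rw [abs_of_nonneg (truncBelow_nonneg (hx0 n) K ω)]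
      exact truncBelow_le K ω
    · simp only [mul_one]
      exact add_le_add_left (hsi K) _
  have h3 := (hr0.const_mul (N : ℝ)).const_add (∫ ω, f ω ∂ν)
  rw [mul_zero, add_zero] at h3
  exact ge_of_tendsto' h3 key

/-- If the truncations of nonnegative functions have hereditary Cesàro limits increasing to a
square integrable function and the functions are tight, then a subsequence converges hereditarily
in Cesàro mean. -/
theorem exists_subseq_hereditaryCesaro_of_tight
    (hx : ∀ n, Measurable (x n)) (hx0 : ∀ n ω, 0 ≤ x n ω) (hs : ∀ K, Measurable (s K))
    (hs0 : ∀ K ω, 0 ≤ s K ω) (hsf : ∀ K, ∀ᵐ ω ∂ν, s K ω ≤ f ω)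
    (hlim : ∀ᵐ ω ∂ν, Tendsto (fun K => s K ω) atTop (𝓝 (f ω))) (hf : MemLp f 2 ν)
    (hxs : ∀ K, HereditaryCesaro ν (fun n => truncBelow (x n) K) (s K))
    (hr : ∀ K : ℕ, Tendsto (fun n => ν.real {ω | (K : ℝ) ≤ x n ω}) atTop (𝓝 (r K)))
    (hr0 : Tendsto r atTop (𝓝 0)) :
    ∃ φ : ℕ → ℕ, StrictMono φ ∧ HereditaryCesaro ν (fun n => x (φ n)) f := by
  have hrs : Summable r := summable_tail_of_hereditaryCesaro_truncBelow hx hx0 hs0 hsf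
    (hf.integrable one_le_two) hxs hr hr0
  have hrn : ∀ K, 0 ≤ r K := fun K => ge_of_tendsto' (hr K) fun n => measureReal_nonneg
  -- The summable slack makes the tails at finite `n` eventually at most `b K`.
  set b : ℕ → ℝ := fun K => r K + (1 / 2 : ℝ) ^ K with hb
  have hb0 : ∀ K, 0 ≤ b K := fun K => add_nonneg (hrn K) (by positivity)
  have hbs : Summable b := hrs.add summable_geometric_two
  have hTabs : ∀ n K ω, |truncBelow (x n) K ω| ≤ K := fun n K ω => by
    rw [abs_of_nonneg (truncBelow_nonneg (hx0 n) K ω)]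
    exact truncBelow_le K ω
  have hT : ∀ n K, MemLp (truncBelow (x n) K) 2 ν := fun n K =>
    MemLp.of_bound (measurable_truncBelow (hx n) K).aestronglyMeasurable (K : ℝ)
      (Eventually.of_forall (hTabs n K))
  have hsL : ∀ K, MemLp (s K) 2 ν := fun K => hf.mono (hs K).aestronglyMeasurable (by
    filter_upwards [hsf K] with ω hω
    rw [Real.norm_eq_abs, Real.norm_eq_abs, abs_of_nonneg (hs0 K ω)]
    exact hω.trans (le_abs_self _))
  set Z : ℕ → ℕ → Ω → ℝ := fun n K ω => truncBelow (x n) K ω - s K ω with hZdef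
  have hZ : ∀ n K, MemLp (Z n K) 2 ν := fun n K => (hT n K).sub (hsL K)
  have hweak : ∀ m i l, Tendsto (fun n => ∫ ω, Z m i ω * Z n l ω ∂ν) atTop (𝓝 0) := by
    intro m i l
    have h1 := ((hxs l).tendsto_integral_mul
      (fun n => (measurable_truncBelow (hx n) l).aestronglyMeasurable)
      (fun n ω => hTabs n l ω) ((hZ m i).integrable one_le_two)).sub_const
      (∫ ω, s l ω * Z m i ω ∂ν)
    rw [sub_self] at h1
    refine h1.congr fun n => ?_
    rw [← integral_sub (by exact (hT n l).integrable_mul (hZ m i))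
      (by exact (hsL l).integrable_mul (hZ m i))]
    refine integral_congr_ae (Eventually.of_forall fun ω => ?_)
    simp only [hZdef]
    ring
  -- Along `σ`, the term `x (φ (σ i))` is truncated at its position `i ≤ σ i`, unknown in advance;
  -- hence all these levels are controlled.
  obtain ⟨φ, hφ, hQ, hP⟩ := exists_strictMono_forall_pair
    (Q := fun j n => ∀ K ∈ Finset.range (j + 1), ν.real {ω | (K : ℝ) ≤ x n ω} ≤ b K)
    (P := fun j m n => ∀ i ∈ Finset.range (m + 1), ∀ l ∈ Finset.range (j + 1),
      |∫ ω, Z m i ω * Z n l ω ∂ν| ≤ 1 / ((j : ℝ) + 1))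
    (fun j => (Finset.eventually_all _).2 fun K _ => (hr K).eventually_le_const
      (lt_add_of_pos_right _ (by positivity)))
    (fun j m => (Finset.eventually_all _).2 fun i _ => (Finset.eventually_all _).2 fun l _ => by
      have h := (hweak m i l).abs
      rw [abs_zero] at h
      exact h.eventually_le_const (by positivity))
  refine ⟨φ, hφ, fun σ hσ => ?_⟩
  have hσi : ∀ i, i ≤ σ i := fun i => hσ.le_apply
  have htail : ∀ i k : ℕ, k ≤ i → ν.real {ω | (k : ℝ) ≤ x (φ (σ i)) ω} ≤ b k := fun i k hk =>
    hQ (σ i) k (Finset.mem_range.2 (by have := hσi i; omega))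
  have hT2 : ∀ i, ∫ ω, truncBelow (x (φ (σ i))) i ω ^ 2 ∂ν ≤
      ∑ k ∈ Finset.range i, (2 * (k : ℝ) + 1) * b k := by
    intro i
    have hms : ∀ k : ℕ, MeasurableSet {ω | (k : ℝ) ≤ x (φ (σ i)) ω} := fun k =>
      measurableSet_le measurable_const (hx _)
    have hint : ∀ k : ℕ, Integrable (fun ω => (2 * (k : ℝ) + 1) *
        Set.indicator {ω | (k : ℝ) ≤ x (φ (σ i)) ω} (1 : Ω → ℝ) ω) ν := fun k =>
      ((integrable_const (1 : ℝ)).indicator (hms k)).const_mul _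
    refine (integral_mono (hT _ i).integrable_sq (integrable_finsetSum _ fun k _ => hint k)
      (truncBelow_sq_le (hx0 _) i)).trans ?_
    rw [integral_finsetSum _ fun k _ => hint k]
    refine Finset.sum_le_sum fun k hk => ?_
    rw [integral_const_mul, integral_indicator_one (hms k)]
    have := htail i k (Finset.mem_range.1 hk).le
    gcongr
  have hs2 : ∀ i, ∫ ω, s i ω ^ 2 ∂ν ≤ ∫ ω, f ω ^ 2 ∂ν := fun i =>
    integral_mono_of_nonneg (Eventually.of_forall fun ω => sq_nonneg _) hf.integrable_sq (by
      filter_upwards [hsf i] with ω hω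
      exact pow_le_pow_left₀ (hs0 i ω) hω 2)
  refine ae_tendsto_average_of_quasiOrthogonal (Z := fun i => Z (φ (σ i)) i) (s := s)
    (v := fun i => 2 * ∑ k ∈ Finset.range i, (2 * (k : ℝ) + 1) * b k + 2 * ∫ ω, f ω ^ 2 ∂ν)
    (fun i => hZ _ _) (fun i l hil => ?_) (fun i => ?_) ?_ (fun i ω => hx0 _ ω) hlim ?_
  · refine (hP _ _ (hσ hil) i (Finset.mem_range.2 ?_) l (Finset.mem_range.2 ?_)).trans ?_
    · have := hσi i
      have := hφ.le_apply (x := σ i)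
      omega
    · have := hσi l
      omega
    · have := hσi l
      gcongr
  · have h1 : ∫ ω, Z (φ (σ i)) i ω ^ 2 ∂ν ≤
        ∫ ω, (2 * truncBelow (x (φ (σ i))) i ω ^ 2 + 2 * s i ω ^ 2) ∂ν :=
      integral_mono (hZ _ _).integrable_sq
        (((hT _ i).integrable_sq.const_mul 2).add ((hsL i).integrable_sq.const_mul 2)) fun ω => by
          simp only [hZdef]
          nlinarith [sq_nonneg (truncBelow (x (φ (σ i))) i ω + s i ω)]
    rw [integral_add ((hT _ i).integrable_sq.const_mul 2) ((hsL i).integrable_sq.const_mul 2),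
      integral_const_mul, integral_const_mul] at h1
    linarith [hT2 i, hs2 i]
  · have h3 := (summable_nat_add_iff 1).2 (Real.summable_one_div_nat_pow (p := 2) |>.2 one_lt_two)
    refine (((summable_sum_odd_mul_div_sq hb0 hbs).mul_left 2).add
      (h3.mul_left (2 * ∫ ω, f ω ^ 2 ∂ν))).congr fun i => ?_
    push_cast
    ring
  -- Borel–Cantelli: almost everywhere, truncation at level `i` eventually changes nothing.
  · have h1 : ∑' i : ℕ, ν {ω | (i : ℝ) ≤ x (φ (σ i)) ω} ≠ ∞ := by
      refine ne_top_of_le_ne_top hbs.tsum_ofReal_ne_top (ENNReal.tsum_le_tsum fun i => ?_)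
      rw [← ofReal_measureReal]
      exact ENNReal.ofReal_le_ofReal (htail i i le_rfl)
    filter_upwards [ae_eventually_notMem h1] with ω hω
    filter_upwards [hω] with i hi
    have h2 : x (φ (σ i)) ω < i := not_le.1 hi
    simp [hZdef, truncBelow_apply, h2]

end

/-! ### Pieces and infinite limits. -/

section

variable {Ω : Type*} {h : Ω → ℝ}

theorem truncatedPiece_apply (h : Ω → ℝ) (k : ℕ) (ω : Ω) :
    truncatedPiece h k ω = if (k : ℝ) ≤ h ω ∧ h ω < (k : ℝ) + 1 then h ω else 0 := by
  simp [truncatedPiece, Set.indicator_apply]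

theorem truncatedPiece_nonneg (hh : ∀ ω, 0 ≤ h ω) (k : ℕ) (ω : Ω) : 0 ≤ truncatedPiece h k ω :=
  Set.indicator_nonneg (fun ω _ => hh ω) ω

theorem truncatedPiece_le (k : ℕ) (ω : Ω) : truncatedPiece h k ω ≤ (k : ℝ) + 1 := by
  rw [truncatedPiece_apply]
  split_ifs with h1
  · exact h1.2.le
  · positivity

theorem measurable_truncatedPiece [MeasurableSpace Ω] (hh : Measurable h) (k : ℕ) :
    Measurable (truncatedPiece h k) :=
  hh.indicator ((measurableSet_le measurable_const hh).inter (measurableSet_lt hh measurable_const))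

theorem sum_truncatedPiece (hh : ∀ ω, 0 ≤ h ω) (K : ℕ) (ω : Ω) :
    ∑ k ∈ Finset.range K, truncatedPiece h k ω = truncBelow h K ω := by
  induction K with
  | zero => simp [truncBelow_apply, not_lt.2 (hh ω)]
  | succ K ih =>
    rw [Finset.sum_range_succ, ih, truncBelow_apply, truncBelow_apply, truncatedPiece_apply]
    push_cast
    split_ifs <;> grind

theorem maxTopOn_of_mem (f : Ω → ℝ≥0∞) {A : Set Ω} {ω : Ω} (hω : ω ∈ A) :
    maxTopOn f A ω = ∞ := by
  simp [maxTopOn, hω]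

theorem maxTopOn_of_notMem (f : Ω → ℝ≥0∞) {A : Set Ω} {ω : Ω} (hω : ω ∉ A) :
    maxTopOn f A ω = f ω := by
  simp [maxTopOn, hω]

theorem maxTopOn_setOf_eq_top (f : Ω → ℝ≥0∞) : maxTopOn f {ω | f ω = ∞} = f := by
  funext ω
  by_cases hω : f ω = ∞
  · rw [maxTopOn_of_mem f hω, hω]
  · exact maxTopOn_of_notMem f hω

theorem measurable_maxTopOn [MeasurableSpace Ω] {f : Ω → ℝ≥0∞} (hf : Measurable f) {A : Set Ω}
    (hA : MeasurableSet A) : Measurable (maxTopOn f A) :=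
  hf.max ((measurable_const.indicator hA).const_mul _)

theorem tendsto_coe_average_nhds_top {x : ℕ → ℝ}
    (hx : ∀ M : ℝ, ∃ y : ℕ → ℝ, ∃ g : ℝ, (∀ j, y j ≤ x j) ∧ M < g ∧
      Tendsto (fun J : ℕ => (∑ j ∈ Finset.range J, y j) / (J : ℝ)) atTop (𝓝 g)) :
    Tendsto (fun J : ℕ => ((1 / (J : ℝ) * ∑ j ∈ Finset.range J, x j : ℝ) : EReal))
      atTop (𝓝 ⊤) := by
  rw [EReal.tendsto_coe_nhds_top_iff, tendsto_atTop]
  intro M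
  obtain ⟨y, g, hyx, hM, hy⟩ := hx M
  filter_upwards [hy.eventually_const_lt hM] with J hJ
  refine hJ.le.trans ?_
  rw [one_div, inv_mul_eq_div]
  gcongr with j _
  exact hyx j

end

/-! ### Extraction for the pieces and identification of the limit. -/

section

variable {Ω : Type*} [MeasurableSpace Ω] {μ : Measure Ω}

theorem convergesHereditarilyInCesaroMean_coe_iff {u : ℕ → Ω → ℝ} {g : Ω → ℝ}
    (hg : Measurable g) :
    ConvergesHereditarilyInCesaroMean μ u (fun ω => (g ω : EReal)) ↔ HereditaryCesaro μ u g := by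
  simp only [ConvergesHereditarilyInCesaroMean, HereditaryCesaro, hg.coe_real_ereal, true_and,
    EReal.tendsto_coe, one_div, inv_mul_eq_div]

namespace ConvergesHereditarilyInCesaroMean

variable {u : ℕ → Ω → ℝ} {g g' : Ω → EReal}

theorem comp_strictMono (h : ConvergesHereditarilyInCesaroMean μ u g) {φ : ℕ → ℕ}
    (hφ : StrictMono φ) : ConvergesHereditarilyInCesaroMean μ (fun n => u (φ n)) g :=
  ⟨h.1, fun ψ hψ => h.2 (fun j => φ (ψ j)) (hφ.comp hψ)⟩

theorem congr_ae (h : ConvergesHereditarilyInCesaroMean μ u g) (hg' : Measurable g')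
    (hgg' : g =ᵐ[μ] g') : ConvergesHereditarilyInCesaroMean μ u g' :=
  ⟨hg', fun φ hφ => by
    filter_upwards [h.2 φ hφ, hgg'] with ω h1 h2
    rwa [← h2]⟩

theorem ae_eq (h : ConvergesHereditarilyInCesaroMean μ u g)
    (h' : ConvergesHereditarilyInCesaroMean μ u g') : g =ᵐ[μ] g' := by
  filter_upwards [h.2 id strictMono_id, h'.2 id strictMono_id] with ω h1 h2
  exact tendsto_nhds_unique h1 h2

end ConvergesHereditarilyInCesaroMean

/-- Dividing the `k`-th piece by `k + 1` brings it into `[0, 1]`. -/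
theorem exists_subseq_arePieceLimits [IsFiniteMeasure μ] {f : ℕ → Ω → ℝ}
    (hf : ∀ n, Measurable (f n)) (hf0 : ∀ n ω, 0 ≤ f n ω) :
    ∃ φ : ℕ → ℕ, StrictMono φ ∧ ∃ F : ℕ → Ω → ℝ≥0, ArePieceLimits μ (fun n => f (φ n)) F := by
  obtain ⟨φ, hφ, g, hg⟩ := exists_subseq_forall_hereditaryCesaro_of_mem_Icc (μ := μ)
    (u := fun k n ω => truncatedPiece (f n) k ω / ((k : ℝ) + 1))
    (fun k n => (measurable_truncatedPiece (hf n) k).div_const _)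
    (fun k n ω => ⟨div_nonneg (truncatedPiece_nonneg (hf0 n) k ω) (by positivity),
      div_le_one_of_le₀ (truncatedPiece_le k ω) (by positivity)⟩)
  refine ⟨φ, hφ, fun k ω => (((k : ℝ) + 1) * g k ω).toNNReal, fun k =>
    ⟨((hg k).1.const_mul _).real_toNNReal, ?_⟩⟩
  have e : ∀ ω, ((((k : ℝ) + 1) * g k ω).toNNReal : ℝ) = ((k : ℝ) + 1) * g k ω := fun ω =>
    Real.coe_toNNReal _ (mul_nonneg (by positivity) ((hg k).2.1 ω).1)
  simp only [e]
  rw [convergesHereditarilyInCesaroMean_coe_iff ((hg k).1.const_mul _)]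
  have h1 := (hg k).2.2.const_mul ((k : ℝ) + 1)
  have e2 : ∀ n ω, ((k : ℝ) + 1) * (truncatedPiece (f (φ n)) k ω / ((k : ℝ) + 1)) =
      truncatedPiece (f (φ n)) k ω := fun n ω => mul_div_cancel₀ _ (by positivity)
  simpa only [e2] using h1

section PieceLimits

variable {x : ℕ → Ω → ℝ} {F : ℕ → Ω → ℝ≥0}

namespace ArePieceLimits

theorem comp_strictMono (hF : ArePieceLimits μ x F) {φ : ℕ → ℕ} (hφ : StrictMono φ) :
    ArePieceLimits μ (fun n => x (φ n)) F :=
  fun k => ⟨(hF k).1, (hF k).2.comp_strictMono hφ⟩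

theorem measurable_pieceSum (hF : ArePieceLimits μ x F) : Measurable (pieceSum F) :=
  Measurable.tsum fun k => (hF k).1.coe_nnreal_ennreal

theorem hereditaryCesaro_truncBelow (hF : ArePieceLimits μ x F) (hx0 : ∀ n ω, 0 ≤ x n ω) (K : ℕ) :
    HereditaryCesaro μ (fun n => truncBelow (x n) K)
      (fun ω => ∑ k ∈ Finset.range K, (F k ω : ℝ)) := by
  have h := HereditaryCesaro.finset_sum (Finset.range K) fun k _ =>
    (convergesHereditarilyInCesaroMean_coe_iff (hF k).1.coe_nnreal_real).1 (hF k).2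
  simp only [sum_truncatedPiece (hx0 _)] at h
  exact h

end ArePieceLimits

theorem tendsto_ofReal_sum_pieceSum {Ω : Type*} (F : ℕ → Ω → ℝ≥0) (ω : Ω) :
    Tendsto (fun K => ENNReal.ofReal (∑ k ∈ Finset.range K, (F k ω : ℝ))) atTop
      (𝓝 (pieceSum F ω)) := by
  refine (ENNReal.tendsto_nat_tsum fun k => (F k ω : ℝ≥0∞)).congr fun K => ?_
  rw [ENNReal.ofReal_sum_of_nonneg fun _ _ => NNReal.coe_nonneg _]
  simp

/-- Where the truncated limits sum to infinity or the mass escapes, averages tend to infinity. -/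
theorem ae_tendsto_coe_average_nhds_top (hF : ArePieceLimits μ x F) (hx0 : ∀ n ω, 0 ≤ x n ω)
    {q : ℕ → Ω → ℝ} (hq0 : ∀ K ω, 0 ≤ q K ω)
    (hq : ∀ K : ℕ, HereditaryCesaro μ (fun n => Set.indicator {ω | (K : ℝ) ≤ x n ω} 1) (q K))
    {φ : ℕ → ℕ} (hφ : StrictMono φ) :
    ∀ᵐ ω ∂μ, (pieceSum F ω = ∞ ∨ ¬ Tendsto (fun K => q K ω) atTop (𝓝 0)) →
      Tendsto (fun J : ℕ => ((1 / (J : ℝ) * ∑ j ∈ Finset.range J, x (φ j) ω : ℝ) : EReal))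
        atTop (𝓝 ⊤) := by
  filter_upwards [ae_all_iff.2 fun K => hF.hereditaryCesaro_truncBelow hx0 K φ hφ,
    ae_all_iff.2 fun K : ℕ => (hq K).const_mul K φ hφ] with ω h1 h2 hω
  refine tendsto_coe_average_nhds_top fun M => ?_
  rcases hω with hω | hω
  · have h3 := tendsto_ofReal_sum_pieceSum F ω
    rw [hω] at h3
    obtain ⟨K, hK⟩ := (h3.eventually_const_lt (ENNReal.ofReal_lt_top (r := M))).exists
    refine ⟨_, _, fun j => ?_, (ENNReal.ofReal_lt_ofReal_iff'.1 hK).1, h1 K⟩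
    rw [truncBelow_apply]
    split_ifs
    · exact le_rfl
    · exact hx0 _ ω
  · rw [Metric.tendsto_atTop] at hω
    push Not at hω
    obtain ⟨ε, hε, hfreq⟩ := hω
    -- The minorant is `K` times the indicator of `{x ≥ K}`, with limit `K * q K ω ≥ K * ε`; a large
    -- enough `K` beats `M`.
    obtain ⟨N, hN⟩ := exists_nat_gt (M / ε)
    obtain ⟨K, hK, hqK⟩ := hfreq N
    rw [Real.dist_eq, sub_zero, abs_of_nonneg (hq0 K ω)] at hqK
    refine ⟨_, _, fun j => ?_, ?_, h2 K⟩
    · by_cases hj : (K : ℝ) ≤ x (φ j) ω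
      · rw [Set.indicator_of_mem (by exact hj)]
        simpa using hj
      · rw [Set.indicator_of_notMem (by exact hj)]
        simpa using hx0 _ ω
    · have hNK : (N : ℝ) ≤ K := by exact_mod_cast hK
      rw [div_lt_iff₀ hε] at hN
      calc M < N * ε := hN
        _ ≤ K * q K ω := by gcongr

/-- A finite measure with the same null sets for which a given function is square integrable. -/
theorem exists_isFiniteMeasure_memLp_two [IsFiniteMeasure μ] {f : Ω → ℝ} (hf : Measurable f) :
    ∃ ν : Measure Ω, IsFiniteMeasure ν ∧ ν ≪ μ ∧ μ ≪ ν ∧ MemLp f 2 ν := by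
  set w : Ω → ℝ≥0∞ := fun ω => ENNReal.ofReal (1 + f ω ^ 2)⁻¹ with hw
  have hwm : Measurable w := ((hf.pow_const 2).const_add 1).inv.ennreal_ofReal
  have hpos : ∀ ω, 0 < 1 + f ω ^ 2 := fun ω => by positivity
  refine ⟨μ.withDensity w, isFiniteMeasure_withDensity ?_, withDensity_absolutelyContinuous _ _,
    withDensity_absolutelyContinuous' hwm.aemeasurable (Eventually.of_forall fun ω => ?_), ?_⟩
  · refine ne_top_of_le_ne_top (measure_ne_top μ Set.univ) ?_
    rw [← lintegral_one]
    refine lintegral_mono fun ω => ENNReal.ofReal_le_one.2 (inv_le_one_of_one_le₀ ?_)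
    linarith [sq_nonneg (f ω)]
  · exact (ENNReal.ofReal_pos.2 (inv_pos.2 (hpos ω))).ne'
  · rw [memLp_two_iff_integrable_sq hf.aestronglyMeasurable]
    refine ⟨(hf.pow_const 2).aestronglyMeasurable, ?_⟩
    rw [hasFiniteIntegral_iff_ofReal (Eventually.of_forall fun ω => sq_nonneg _),
      lintegral_withDensity_eq_lintegral_mul _ hwm (hf.pow_const 2).ennreal_ofReal]
    refine lt_of_le_of_lt ?_ (measure_lt_top μ Set.univ)
    rw [← lintegral_one]
    refine lintegral_mono fun ω => ?_
    rw [Pi.mul_apply, hw, ← ENNReal.ofReal_mul (inv_nonneg.2 (hpos ω).le)]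
    refine ENNReal.ofReal_le_one.2 ?_
    rw [inv_mul_le_one₀ (hpos ω)]
    linarith

/-- Along a subsequence the asymptotic probabilities of exceeding `K` have densities `q K`, and the
functions converge hereditarily in Cesàro mean, to infinity exactly where the pieces sum to
infinity or `q K` does not vanish as `K → ∞`. -/
theorem exists_subseq_converges_maxTopOn [IsFiniteMeasure μ] (hx : ∀ n, Measurable (x n))
    (hx0 : ∀ n ω, 0 ≤ x n ω) (hF : ArePieceLimits μ x F) :
    ∃ ψ : ℕ → ℕ, StrictMono ψ ∧ ∃ q : ℕ → Ω → ℝ, (∀ K, Measurable (q K)) ∧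
      (∀ K ω, q K ω ∈ Set.Icc (0 : ℝ) 1) ∧
      (∀ K : ℕ, HereditaryCesaro μ
        (fun n => Set.indicator {ω | (K : ℝ) ≤ x (ψ n) ω} 1) (q K)) ∧
      MeasurableSet {ω | pieceSum F ω = ∞ ∨ ¬ Tendsto (fun K => q K ω) atTop (𝓝 0)} ∧
      ConvergesHereditarilyInCesaroMean μ (fun n => x (ψ n))
        (fun ω => (maxTopOn (pieceSum F)
          {ω | pieceSum F ω = ∞ ∨ ¬ Tendsto (fun K => q K ω) atTop (𝓝 0)} ω : EReal)) := by
  have hms : ∀ (K : ℕ) n, MeasurableSet {ω | (K : ℝ) ≤ x n ω} := fun K n =>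
    measurableSet_le measurable_const (hx n)
  have hind01 : ∀ (K n : ℕ) ω,
      Set.indicator {ω | (K : ℝ) ≤ x n ω} (1 : Ω → ℝ) ω ∈ Set.Icc (0 : ℝ) 1 := fun K n ω =>
    ⟨Set.indicator_nonneg (fun _ _ => zero_le_one) ω,
      Set.indicator_le_self' (f := (1 : Ω → ℝ)) (fun _ _ => zero_le_one) ω⟩
  have hindm : ∀ (K n : ℕ), Measurable (Set.indicator {ω | (K : ℝ) ≤ x n ω} (1 : Ω → ℝ)) :=
    fun K n => measurable_const.indicator (hms K n)
  obtain ⟨ψ, hψ, q, hq⟩ := exists_subseq_forall_hereditaryCesaro_of_mem_Icc (μ := μ)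
    (u := fun K n => Set.indicator {ω | (K : ℝ) ≤ x n ω} (1 : Ω → ℝ)) hindm hind01
  have hfm : Measurable (pieceSum F) := hF.measurable_pieceSum
  set A : Set Ω := {ω | pieceSum F ω = ∞ ∨ ¬ Tendsto (fun K => q K ω) atTop (𝓝 0)} with hA
  have hAm : MeasurableSet A := (hfm (measurableSet_singleton ∞)).union
    (measurableSet_tendsto (𝓝 0) fun K => (hq K).1).compl
  have hAc : ∀ {ω}, ω ∈ Aᶜ → pieceSum F ω ≠ ∞ ∧ Tendsto (fun K => q K ω) atTop (𝓝 0) :=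
    fun {ω} hω => by simpa [hA, not_or] using hω
  -- Off `A` the sum is finite but perhaps not integrable; an equivalent measure repairs this
  -- without changing a.e. statements there.
  obtain ⟨ν, hνfin, hνμ, hμν, hfL⟩ := exists_isFiniteMeasure_memLp_two (μ := μ.restrict Aᶜ)
    hfm.ennreal_toReal
  have hνμ' : ν ≪ μ := hνμ.trans Measure.restrict_le_self.absolutelyContinuous
  have hνA : ∀ᵐ ω ∂ν, ω ∈ Aᶜ := hνμ.ae_le (ae_restrict_mem hAm.compl)
  have hlim : ∀ ω ∈ Aᶜ, Tendsto (fun K => ∑ k ∈ Finset.range K, (F k ω : ℝ)) atTop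
      (𝓝 (pieceSum F ω).toReal) := fun ω hω => by
    refine ((ENNReal.tendsto_toReal (hAc hω).1).comp (tendsto_ofReal_sum_pieceSum F ω)).congr
      fun K => ?_
    exact ENNReal.toReal_ofReal (Finset.sum_nonneg fun _ _ => NNReal.coe_nonneg _)
  obtain ⟨θ, hθ, hHC⟩ := exists_subseq_hereditaryCesaro_of_tight (ν := ν)
    (x := fun n => x (ψ n)) (s := fun K ω => ∑ k ∈ Finset.range K, (F k ω : ℝ))
    (f := fun ω => (pieceSum F ω).toReal) (r := fun K => ∫ ω, q K ω * 1 ∂ν)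
    (fun n => hx _) (fun n => hx0 _)
    (fun K => Finset.measurable_fun_sum _ fun k _ => (hF k).1.coe_nnreal_real)
    (fun K ω => Finset.sum_nonneg fun _ _ => NNReal.coe_nonneg _)
    (fun K => by
      filter_upwards [hνA] with ω hω
      refine Monotone.ge_of_tendsto (fun a b hab => ?_) (hlim ω hω) K
      exact Finset.sum_le_sum_of_subset_of_nonneg (Finset.range_mono hab)
        fun _ _ _ => NNReal.coe_nonneg _)
    (by filter_upwards [hνA] with ω hω using hlim ω hω) hfL
    (fun K => ((hF.comp_strictMono hψ).hereditaryCesaro_truncBelow (fun n => hx0 _)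
      K).of_absolutelyContinuous hνμ')
    (fun K => by
      have h := ((hq K).2.2.of_absolutelyContinuous hνμ').tendsto_integral_mul
        (fun n => (hindm K _).aestronglyMeasurable) (C := 1)
        (fun n ω => by rw [abs_of_nonneg (hind01 K _ ω).1]; exact (hind01 K _ ω).2)
        (integrable_const 1)
      refine h.congr fun n => ?_
      simp only [mul_one]
      exact integral_indicator_one (hms K _))
    (by
      have h := tendsto_integral_of_dominated_convergence (μ := ν) (F := fun K ω => q K ω * 1)
        (f := fun _ => (0 : ℝ)) (fun _ => 1)
        (fun K => ((hq K).1.mul_const 1).aestronglyMeasurable) (integrable_const 1)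
        (fun K => Eventually.of_forall fun ω => by
          rw [mul_one, Real.norm_eq_abs, abs_of_nonneg ((hq K).2.1 ω).1]
          exact ((hq K).2.1 ω).2)
        (by
          filter_upwards [hνA] with ω hω
          simpa only [mul_one] using (hAc hω).2)
      simpa only [integral_zero] using h)
  have hqθ : ∀ K : ℕ, HereditaryCesaro μ
      (fun n => Set.indicator {ω | (K : ℝ) ≤ x (ψ (θ n)) ω} 1) (q K) := fun K =>
    (hq K).2.2.comp_strictMono hθ
  refine ⟨fun n => ψ (θ n), hψ.comp hθ, q, fun K => (hq K).1, fun K => (hq K).2.1, hqθ, hAm,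
    (measurable_maxTopOn hfm hAm).coe_ereal_ennreal, fun σ hσ => ?_⟩
  have hfin := (ae_restrict_iff' hAm.compl).1 ((hHC.of_absolutelyContinuous hμν) σ hσ)
  filter_upwards [hfin, ae_tendsto_coe_average_nhds_top (hF.comp_strictMono (hψ.comp hθ))
    (fun n => hx0 _) (fun K ω => ((hq K).2.1 ω).1) hqθ hσ] with ω h1 h2
  by_cases hω : ω ∈ A
  · rw [maxTopOn_of_mem _ hω]
    exact h2 hω
  · rw [maxTopOn_of_notMem _ hω, ← EReal.coe_ennreal_toReal (hAc hω).1, EReal.tendsto_coe]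
    simpa only [one_div, inv_mul_eq_div] using h1 hω

/-- Under asymptotic boundedness on `{f < ∞}` a hereditary Cesàro limit is finite there. -/
theorem ae_eq_of_asymptoticallyBoundedOnFinite [IsFiniteMeasure μ] (hx : ∀ n, Measurable (x n))
    (hx0 : ∀ n ω, 0 ≤ x n ω) (hF : ArePieceLimits μ x F) {A : Set Ω}
    (hsub : {ω | pieceSum F ω = ∞} ⊆ A)
    (hA : ConvergesHereditarilyInCesaroMean μ x (fun ω => (maxTopOn (pieceSum F) A ω : EReal)))
    (hb : AsymptoticallyBoundedOnFinite μ x (pieceSum F)) :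
    A =ᵐ[μ] {ω | pieceSum F ω = ∞} ∧ maxTopOn (pieceSum F) A =ᵐ[μ] pieceSum F := by
  obtain ⟨ψ, hψ, q, hqm, hq01, hq, -, hconv⟩ := exists_subseq_converges_maxTopOn hx hx0 hF
  have hfm : Measurable (pieceSum F) := hF.measurable_pieceSum
  set D : Set Ω := {ω | pieceSum F ω < ∞}
  have hDm : MeasurableSet D := measurableSet_lt hfm measurable_const
  have hms : ∀ (K : ℕ) n, MeasurableSet {ω | (K : ℝ) ≤ x n ω} := fun K n =>
    measurableSet_le measurable_const (hx n)
  -- The left side is the limit of the same probabilities along `ψ`.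
  have hqle : ∀ K : ℕ, ∫⁻ ω in D, ENNReal.ofReal (q K ω) ∂μ ≤
      limsup (fun n : ℕ => μ {ω | (K : ℝ) ≤ x n ω ∧ pieceSum F ω < ∞}) atTop := by
    intro K
    have h1 := ((hq K).of_absolutelyContinuous
      (Measure.restrict_le_self (s := D)).absolutelyContinuous).tendsto_integral_mul
      (fun n => (measurable_const.indicator (hms K _)).aestronglyMeasurable) (C := 1)
      (fun n ω => by
        rw [abs_of_nonneg (Set.indicator_nonneg (f := (1 : Ω → ℝ)) (fun _ _ => zero_le_one) ω)]
        exact Set.indicator_le_self' (f := (1 : Ω → ℝ)) (fun _ _ => zero_le_one) ω)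
      (integrable_const 1)
    simp only [mul_one] at h1
    have h2 : Tendsto (fun n => μ {ω | (K : ℝ) ≤ x (ψ n) ω ∧ pieceSum F ω < ∞}) atTop
        (𝓝 (∫⁻ ω in D, ENNReal.ofReal (q K ω) ∂μ)) := by
      rw [← ofReal_integral_eq_lintegral_ofReal
        (Integrable.of_bound (hqm K).aestronglyMeasurable 1 (Eventually.of_forall fun ω => by
          rw [Real.norm_eq_abs, abs_of_nonneg (hq01 K ω).1]; exact (hq01 K ω).2))
        (Eventually.of_forall fun ω => (hq01 K ω).1)]
      refine (ENNReal.tendsto_ofReal h1).congr fun n => ?_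
      rw [integral_indicator_one (hms K _), ofReal_measureReal, Measure.restrict_apply (hms K _)]
      rfl
    rw [← h2.limsup_eq]
    exact limsup_le_limsup_of_le (u := fun n : ℕ => μ {ω | (K : ℝ) ≤ x n ω ∧ pieceSum F ω < ∞})
      hψ.tendsto_atTop
  have hinf : ∫⁻ ω in D, ⨅ K, ENNReal.ofReal (q K ω) ∂μ = 0 := by
    refine le_antisymm (ge_of_tendsto' hb fun K => le_trans ?_ (hqle K)) bot_le
    exact lintegral_mono fun ω => iInf_le _ K
  rw [lintegral_eq_zero_iff (Measurable.iInf fun K => (hqm K).ennreal_ofReal)] at hinf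
  have hq0 : ∀ᵐ ω ∂μ, ω ∈ D → Tendsto (fun K => q K ω) atTop (𝓝 0) := by
    filter_upwards [(ae_restrict_iff' hDm).1 hinf, ae_all_iff.2 fun K => hq K id strictMono_id]
      with ω h1 h2 hω
    -- Monotonicity, inherited from the nested sets `{x ≥ K}`, turns the vanishing infimum into a
    -- limit.
    have hanti : Antitone fun K => ENNReal.ofReal (q K ω) := fun K L hKL => by
      refine ENNReal.ofReal_le_ofReal (le_of_tendsto_of_tendsto' (h2 L) (h2 K) fun J => ?_)
      refine div_le_div_of_nonneg_right (Finset.sum_le_sum fun j _ => ?_) (Nat.cast_nonneg J)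
      refine Set.indicator_le_indicator_of_subset (f := (1 : Ω → ℝ)) (fun ω hω => ?_)
        (fun _ => zero_le_one) ω
      exact (Nat.cast_le.2 hKL).trans (show (L : ℝ) ≤ x (ψ j) ω from hω)
    have h3 := tendsto_atTop_iInf hanti
    rw [show ⨅ K, ENNReal.ofReal (q K ω) = 0 from h1 hω] at h3
    refine ((ENNReal.tendsto_toReal ENNReal.zero_ne_top).comp h3).congr fun K => ?_
    exact ENNReal.toReal_ofReal (hq01 K ω).1
  have hmax : maxTopOn (pieceSum F) A =ᵐ[μ] pieceSum F := by
    filter_upwards [(hA.comp_strictMono hψ).ae_eq hconv, hq0] with ω h1 h2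
    rw [EReal.coe_ennreal_eq_coe_ennreal_iff] at h1
    rw [h1]
    by_cases hω : pieceSum F ω = ∞
    · rw [hω]
      exact maxTopOn_of_mem _ (Or.inl hω)
    · exact maxTopOn_of_notMem _ (by
        simp only [Set.mem_ofPred_eq, not_or, not_not]
        exact ⟨hω, h2 (lt_top_iff_ne_top.2 hω)⟩)
  refine ⟨?_, hmax⟩
  filter_upwards [hmax] with ω h1
  refine propext ⟨fun hω => ?_, fun hω => hsub hω⟩
  rw [maxTopOn_of_mem _ hω] at h1
  exact h1.symm

end PieceLimits

end

theorem proposition4 {Ω : Type*} [MeasurableSpace Ω] (μ : Measure Ω) [IsProbabilityMeasure μ]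
    (f : ℕ → Ω → ℝ) (hf_meas : ∀ n, Measurable (f n)) (hf_nonneg : ∀ n ω, 0 ≤ f n ω) :
    -- along some subsequence all the truncated pieces have hereditary Cesàro limits
    (∃ φ : ℕ → ℕ, StrictMono φ ∧ ∃ F : ℕ → Ω → ℝ≥0, ArePieceLimits μ (fun n => f (φ n)) F) ∧
    -- and for every such subsequence, and every choice of the limits:
    ∀ φ : ℕ → ℕ, StrictMono φ → ∀ F : ℕ → Ω → ℝ≥0, ArePieceLimits μ (fun n => f (φ n)) F →
      (∃ ψ : ℕ → ℕ, StrictMono ψ ∧ ∃ A : Set Ω, MeasurableSet A ∧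
        {ω | pieceSum F ω = ∞} ⊆ A ∧
        ConvergesHereditarilyInCesaroMean μ (fun n => f (φ (ψ n)))
          (fun ω => (maxTopOn (pieceSum F) A ω : EReal)) ∧
        (AsymptoticallyBoundedOnFinite μ (fun n => f (φ (ψ n))) (pieceSum F) →
          A = {ω | pieceSum F ω = ∞} ∧ maxTopOn (pieceSum F) A = pieceSum F)) ∧
      -- under the boundedness condition every admissible set is `{f = ∞}`, up to a null set
      (∀ ψ : ℕ → ℕ, StrictMono ψ → ∀ A : Set Ω, MeasurableSet A →
        {ω | pieceSum F ω = ∞} ⊆ A →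
        ConvergesHereditarilyInCesaroMean μ (fun n => f (φ (ψ n)))
          (fun ω => (maxTopOn (pieceSum F) A ω : EReal)) →
        AsymptoticallyBoundedOnFinite μ (fun n => f (φ (ψ n))) (pieceSum F) →
          A =ᵐ[μ] {ω | pieceSum F ω = ∞} ∧ maxTopOn (pieceSum F) A =ᵐ[μ] pieceSum F) := by
  refine ⟨exists_subseq_arePieceLimits hf_meas hf_nonneg, fun φ _ F hF => ⟨?_, ?_⟩⟩
  · obtain ⟨ψ, hψ, q, -, -, -, hAm, hconv⟩ :=
      exists_subseq_converges_maxTopOn (fun n => hf_meas (φ n)) (fun n => hf_nonneg (φ n)) hF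
    have hfm : Measurable (pieceSum F) := hF.measurable_pieceSum
    have hsub : {ω | pieceSum F ω = ∞} ⊆
        {ω | pieceSum F ω = ∞ ∨ ¬ Tendsto (fun K => q K ω) atTop (𝓝 0)} := fun ω hω => Or.inl hω
    -- Equality everywhere is required, so under the condition the constructed set is replaced by
    -- `{f = ∞}`, which alters the limit only on a null set.
    by_cases hb : AsymptoticallyBoundedOnFinite μ (fun n => f (φ (ψ n))) (pieceSum F)
    · have hae := (ae_eq_of_asymptoticallyBoundedOnFinite (fun n => hf_meas (φ (ψ n)))
        (fun n => hf_nonneg (φ (ψ n))) (hF.comp_strictMono hψ) hsub hconv hb).2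
      refine ⟨ψ, hψ, {ω | pieceSum F ω = ∞}, hfm (measurableSet_singleton ∞), subset_rfl, ?_,
        fun _ => ⟨rfl, maxTopOn_setOf_eq_top _⟩⟩
      rw [maxTopOn_setOf_eq_top]
      refine hconv.congr_ae hfm.coe_ereal_ennreal ?_
      filter_upwards [hae] with ω hω
      rw [hω]
    · exact ⟨ψ, hψ, _, hAm, hsub, hconv, fun h => absurd h hb⟩
  · intro ψ hψ A _ hsub hconv hb
    exact ae_eq_of_asymptoticallyBoundedOnFinite (fun n => hf_meas (φ (ψ n)))
      (fun n => hf_nonneg (φ (ψ n))) (hF.comp_strictMono hψ) hsub hconv hb
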